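/- Let $S$ be a semigroup, $\sigma:S\to S$ an automorphism with $\sigma(\sigma(x))=x$ for all $x$, and $f,g,h:S\to\mathbb{C}$. For $u:S\to\mathbb{C}$ put $u^{*}=u\circ\sigma$ and $u^{e}=\frac{u+u^{*}}{2}$; $u$ is even if $u^{*}=u$ and odd if $u^{*}=-u$. A function $\chi:S\to\mathbb{C}$ is multiplicative if $\chi(xy)=\chi(x)\chi(y)$ for all $x,y$ (so $\chi=0$ is multiplicative). For multiplicative $\chi$, a function $\varphi$ is $\chi$-additive if $\varphi(xy)=\varphi(x)\chi(y)+\chi(x)\varphi(y)$ for all $x,y$ (so $0$-additive means zero on $S^2=\{xy\mid x,y\in S\}$), and $\psi$ is of type $(\chi,\tau,\varphi)$-cosine-sine, where $\tau$ is $\sigma$ or the identity, if $\varphi$ is $\chi$-additive and $\psi(x\tau(y))=\psi(x)\chi(y)+\chi(x)\psi(y)+\varphi(x)\varphi(y)$ for all $x,y$; type $(\chi,\varphi)$ means $\tau=\mathrm{id}$. Then $$f(x\sigma(y))=f(x)g(y)+g(x)f(y)+h(x)h(y)\qquad(x,y\in S)$$ holds and $f^{e},h^{e}$ are linearly independent if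 and only if $(f,g,h)$ is of at least one of the following forms. In (A)–(C), $\chi$ is a non-zero even multiplicative function and $\varphi$ is a non-zero even $\chi$-additive function; in (B), (C), $\mu$ is an even multiplicative function with $\mu\neq\chi$ (possibly $\mu=0$). (A) $f=\psi$, $g=\chi$, $h=\varphi$, where $\psi$ is non-zero, even and of type $(\chi,\varphi)$-cosine-sine. (B) $f=c^{2}\mu-c^{2}\chi-c\varphi$, $g=\chi$, $h=c\mu-c\chi$, where $c\in\mathbb{C}\setminus\{0\}$. (C) $f=-a\mu+a\chi-ab\varphi$, $g=\frac12\mu+\frac12\chi-\frac b2\varphi$, $h=\varphi$, where $a,b\in\mathbb{C}\setminus\{0\}$ and $1+ab^{2}=0$. (D) $f=\alpha\rho\chi_1+\alpha(2-\rho)\chi_2-2\alpha\chi_3$, $g=\frac{\rho}{4}\chi_1+\frac{2-\rho}{4}\chi_2+\frac12\chi_3$, $h=\frac{1}{2\lambda}\chi_1-\frac{1}{2\lambda}\chi_2$, where $\chi_1,\chi_2,\chi_3$ are pairwise different even multiplicative functions (so at most one of them is $0$) and $\alpha,\lambda,\rho\in\mathbb{C}\setminus\{0\}$ satisfy $2\alpha\lambda^{2}\rho(2-\rho)=1$.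 (E) $f=f_0$, $g=-\frac{\delta^{2}}{2}f_0+g_0+\delta h_0$, $h=-\delta f_0+h_0$, where $\delta\in\mathbb{C}$ and $(f_0,g_0,h_0)$ is of one of the forms (A)–(D). (F) $f=\Psi_0+k$, $g=-\frac{\beta^{2}}{2}\Psi_0+\beta\Phi_0-\frac{\beta^{2}}{2}k$, $h=-\beta\Psi_0+\Phi_0-\beta k$, where $\beta\in\mathbb{C}$, $\Phi_0$ is non-zero and $0$-additive, $\Psi_0$ is non-zero and of type $(0,\sigma,\Phi_0)$-cosine-sine, $k$ is odd and $0$-additive, and either $\Phi_0$ and $\Psi_0$ are both even, or $k=0$ and $\Phi_0$ is not odd. (G) $f=c^{2}\mu-c\Phi_0+k$, $g=\frac{c\beta(2-c\beta)}{2}\mu+\frac{c\beta^{2}}{2}\Phi_0-\frac{\beta^{2}}{2}k$, $h=c(1-c\beta)\mu+c\beta\Phi_0-\beta k$, where $\beta\in\mathbb{C}$, $c\in\mathbb{C}\setminus\{0\}$, $\mu$ is a non-zero even multiplicative function, $\Phi_0$ is non-zero, even and $0$-additive, and $k$ is odd and $0$-additive. -/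

import Mathlib

namespace CosSine

variable {S : Type*}

/-- `f* = f ∘ σ`. -/
def star (σ : S → S) (f : S → ℂ) : S → ℂ := fun x => f (σ x)

/-- The even part `fᵉ = (f + f*) / 2`. -/
noncomputable def evenPart (σ : S → S) (f : S → ℂ) : S → ℂ :=
  fun x => (f x + f (σ x)) / 2

/-- `f` is even: `f* = f`. -/
def IsEven (σ : S → S) (f : S → ℂ) : Prop := star σ f = f

/-- `f` is odd: `f* = -f`. -/
def IsOdd (σ : S → S) (f : S → ℂ) : Prop := star σ f = -f

/-- Multiplicative functions; the zero function is one of them. -/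
def IsMultiplicative [Semigroup S] (χ : S → ℂ) : Prop :=
  ∀ x y, χ (x * y) = χ x * χ y

/-- `φ` is `χ`-additive; for `χ = 0` this says that `φ` vanishes on `S²`. -/
def IsAdditiveFor [Semigroup S] (χ φ : S → ℂ) : Prop :=
  ∀ x y, φ (x * y) = φ x * χ y + χ x * φ y

/-- `ψ` is of type `(χ, σ, φ)`-cosine-sine. -/
def IsCosSineType [Semigroup S] (χ : S → ℂ) (σ : S → S) (φ ψ : S → ℂ) : Prop :=
  IsAdditiveFor χ φ ∧ ∀ x y, ψ (x * σ y) = ψ x * χ y + χ x * ψ y + φ x * φ y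

/-- The functional equation `f(xσ(y)) = f(x)g(y) + g(x)f(y) + h(x)h(y)`. -/
def IsSolution [Semigroup S] (σ : S → S) (f g h : S → ℂ) : Prop :=
  ∀ x y, f (x * σ y) = f x * g y + g x * f y + h x * h y

/-- Family (A). -/
def FamilyA [Semigroup S] (σ : S → S) (f g h : S → ℂ) : Prop :=
  ∃ χ φ ψ : S → ℂ,
    IsMultiplicative χ ∧ IsEven σ χ ∧ χ ≠ 0 ∧
    IsAdditiveFor χ φ ∧ IsEven σ φ ∧ φ ≠ 0 ∧
    IsCosSineType χ id φ ψ ∧ IsEven σ ψ ∧ ψ ≠ 0 ∧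
    f = ψ ∧ g = χ ∧ h = φ

/-- Family (B). -/
def FamilyB [Semigroup S] (σ : S → S) (f g h : S → ℂ) : Prop :=
  ∃ (μ χ φ : S → ℂ) (c : ℂ),
    IsMultiplicative μ ∧ IsEven σ μ ∧
    IsMultiplicative χ ∧ IsEven σ χ ∧ χ ≠ 0 ∧ χ ≠ μ ∧
    IsAdditiveFor χ φ ∧ IsEven σ φ ∧ φ ≠ 0 ∧
    c ≠ 0 ∧
    f = c ^ 2 • μ - c ^ 2 • χ - c • φ ∧
    g = χ ∧
    h = c • μ - c • χ

/-- Family (C). -/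
def FamilyC [Semigroup S] (σ : S → S) (f g h : S → ℂ) : Prop :=
  ∃ (μ χ φ : S → ℂ) (a b : ℂ),
    IsMultiplicative μ ∧ IsEven σ μ ∧
    IsMultiplicative χ ∧ IsEven σ χ ∧ χ ≠ 0 ∧ χ ≠ μ ∧
    IsAdditiveFor χ φ ∧ IsEven σ φ ∧ φ ≠ 0 ∧
    a ≠ 0 ∧ b ≠ 0 ∧ 1 + a * b ^ 2 = 0 ∧
    f = (-a) • μ + a • χ - (a * b) • φ ∧
    g = (1 / 2 : ℂ) • μ + (1 / 2 : ℂ) • χ - (b / 2) • φ ∧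
    h = φ

/-- Family (D). Since the three functions are different, at most one of them is zero. -/
def FamilyD [Semigroup S] (σ : S → S) (f g h : S → ℂ) : Prop :=
  ∃ (χ₁ χ₂ χ₃ : S → ℂ) (α lam ρ : ℂ),
    IsMultiplicative χ₁ ∧ IsEven σ χ₁ ∧
    IsMultiplicative χ₂ ∧ IsEven σ χ₂ ∧
    IsMultiplicative χ₃ ∧ IsEven σ χ₃ ∧
    χ₁ ≠ χ₂ ∧ χ₁ ≠ χ₃ ∧ χ₂ ≠ χ₃ ∧
    α ≠ 0 ∧ lam ≠ 0 ∧ ρ ≠ 0 ∧ 2 * α * lam ^ 2 * ρ * (2 - ρ) = 1 ∧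
    f = (α * ρ) • χ₁ + (α * (2 - ρ)) • χ₂ - (2 * α) • χ₃ ∧
    g = (ρ / 4) • χ₁ + ((2 - ρ) / 4) • χ₂ + (1 / 2 : ℂ) • χ₃ ∧
    h = (1 / (2 * lam)) • χ₁ - (1 / (2 * lam)) • χ₂

/-- Family (E). -/
def FamilyE [Semigroup S] (σ : S → S) (f g h : S → ℂ) : Prop :=
  ∃ (f₀ g₀ h₀ : S → ℂ) (δ : ℂ),
    (FamilyA σ f₀ g₀ h₀ ∨ FamilyB σ f₀ g₀ h₀ ∨ FamilyC σ f₀ g₀ h₀ ∨ FamilyD σ f₀ g₀ h₀) ∧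
    f = f₀ ∧
    g = (-(δ ^ 2 / 2)) • f₀ + g₀ + δ • h₀ ∧
    h = (-δ) • f₀ + h₀

/-- Family (F). -/
def FamilyF [Semigroup S] (σ : S → S) (f g h : S → ℂ) : Prop :=
  ∃ (Φ₀ Ψ₀ k : S → ℂ) (β : ℂ),
    IsAdditiveFor 0 Φ₀ ∧ Φ₀ ≠ 0 ∧
    IsCosSineType 0 σ Φ₀ Ψ₀ ∧ Ψ₀ ≠ 0 ∧
    IsAdditiveFor 0 k ∧ IsOdd σ k ∧
    ((IsEven σ Φ₀ ∧ IsEven σ Ψ₀) ∨ (k = 0 ∧ ¬ IsOdd σ Φ₀)) ∧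
    f = Ψ₀ + k ∧
    g = (-(β ^ 2 / 2)) • Ψ₀ + β • Φ₀ + (-(β ^ 2 / 2)) • k ∧
    h = (-β) • Ψ₀ + Φ₀ + (-β) • k

/-- Family (G). -/
def FamilyG [Semigroup S] (σ : S → S) (f g h : S → ℂ) : Prop :=
  ∃ (μ Φ₀ k : S → ℂ) (c β : ℂ),
    IsMultiplicative μ ∧ IsEven σ μ ∧ μ ≠ 0 ∧
    IsAdditiveFor 0 Φ₀ ∧ IsEven σ Φ₀ ∧ Φ₀ ≠ 0 ∧
    IsAdditiveFor 0 k ∧ IsOdd σ k ∧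
    c ≠ 0 ∧
    f = c ^ 2 • μ - c • Φ₀ + k ∧
    g = (c * β * (2 - c * β) / 2) • μ + (c * β ^ 2 / 2) • Φ₀ + (-(β ^ 2 / 2)) • k ∧
    h = (c * (1 - c * β)) • μ + (c * β) • Φ₀ + (-β) • k

end CosSine

/-! If `f`, `g`, `h` are even, the involution drops out: `f (x * y)` is `f x * g y + g x * f y + h x
* h y`. Expanding `f` of a triple product in two ways forces `g (x * y)` and `h (x * y)` to be
bilinear in the values at `x` and `y`, with three free constants `p`, `q`, `m`
(`exists_structure_constants`). Then `g + t h + λ f` is multiplicative for a suitable `λ` as soon as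
`t` is a root of `T³ - m T² - 2p T - q`. Up to the shift in (E), three distinct roots give (D), a
double root gives (B), a triple root gives (A). If the multiplicative function of the repeated root
is zero, (G) or (F) appears instead. Form (C) is (B) shifted by `δ = 1 / c`, so it never has to be
produced.

Parity reduces to this case. The right side is symmetric in `x` and `y`, whence `f (x * y) = f (σ (y
* x))`, and the odd part of `f` dies on triple products. If the even parts of `f`, `g`, `h` are
independent, all odd parts vanish. Otherwise a shift makes the even part of `g` a multiple of that
of `f`. Then either everything is even, or the shifted `g` is zero and the equation is short enough
to give (F) or (G). -/

namespace CosSine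

/-- Linear independence of two functions, in terms of pointwise relations. -/
def Indep {X : Type*} (u v : X → ℂ) : Prop :=
  ∀ a b : ℂ, (∀ x, a * u x + b * v x = 0) → a = 0 ∧ b = 0

theorem linearIndependent_pair_iff_indep {X : Type*} (u v : X → ℂ) :
    LinearIndependent ℂ ![u, v] ↔ Indep u v := by
  rw [LinearIndependent.pair_iff]
  refine forall₂_congr fun a b => ?_
  rw [funext_iff]
  simp only [Pi.add_apply, Pi.smul_apply, smul_eq_mul, Pi.zero_apply]

/-! ### Linear independence and coefficient comparison -/

namespace Indep

variable {X : Type*} {u v : X → ℂ}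

theorem add_smul_left (huv : Indep u v) (d : ℂ) : Indep u (fun x => v x + d * u x) := by
  intro a b hab
  obtain ⟨h1, h2⟩ := huv (a + b * d) b fun x => by linear_combination hab x
  exact ⟨by rw [h2] at h1; simpa using h1, h2⟩

theorem exists_det_ne_zero (huv : Indep u v) : ∃ x y, u x * v y - u y * v x ≠ 0 := by
  by_contra! hdet
  have h0 : ∀ y, v y = 0 ∧ -u y = 0 := fun y => huv (v y) (-u y) fun x => by
    linear_combination hdet x y
  have := huv 1 0 fun x => by linear_combination -(h0 x).2
  exact one_ne_zero this.1

/-- If `u ⊗ A + v ⊗ C = A ⊗ u + B ⊗ v`, then `A`, `B = C` are combinations of `u` and `v` with a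
symmetric coefficient matrix. -/
theorem exists_coeff (huv : Indep u v) {A B C : X → ℂ}
    (hAC : ∀ x y, u x * A y + v x * C y = A x * u y + B x * v y) :
    ∃ a b c : ℂ, (∀ x, A x = a * u x + b * v x) ∧ (∀ x, B x = b * u x + c * v x) ∧
      ∀ x, C x = b * u x + c * v x := by
  obtain ⟨s, t, hd⟩ := huv.exists_det_ne_zero
  have hA : ∃ a b : ℂ, ∀ x, A x = a * u x + b * v x := by
    -- Cramer's rule: eliminate `B x` between the relations at `y = s` and `y = t`.
    refine ⟨(A s * v t - A t * v s) / (u s * v t - u t * v s),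
      (C s * v t - C t * v s) / (u s * v t - u t * v s), fun x => ?_⟩
    rw [div_mul_eq_mul_div, div_mul_eq_mul_div, ← add_div, eq_div_iff hd]
    linear_combination v s * hAC x t - v t * hAC x s
  have hB : ∃ b' c : ℂ, ∀ x, B x = b' * u x + c * v x := by
    refine ⟨(A t * u s - A s * u t) / (u s * v t - u t * v s),
      (C t * u s - C s * u t) / (u s * v t - u t * v s), fun x => ?_⟩
    rw [div_mul_eq_mul_div, div_mul_eq_mul_div, ← add_div, eq_div_iff hd]
    linear_combination u t * hAC x s - u s * hAC x t
  obtain ⟨a, b, hA⟩ := hA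
  obtain ⟨b', c, hB⟩ := hB
  have key : ∀ y, A y - a * u y - b' * v y = 0 ∧ C y - b * u y - c * v y = 0 := fun y =>
    huv _ _ fun x => by linear_combination hAC x y + u y * hA x + v y * hB x
  have hbb : b - b' = 0 := by
    refine (huv 0 (b - b') fun y => ?_).2
    linear_combination (key y).1 - hA y
  have hb : b' = b := by linear_combination -hbb
  subst hb
  exact ⟨a, b', c, hA, hB, fun x => by linear_combination (key x).2⟩

end Indep

/-! ### Structure constants from associativity -/

/-- On a monoid, a normalized solution of the cosine-sine equation closes up under products. -/
theorem exists_structure_constants_monoid {M : Type*} [Monoid M] {f g h : M → ℂ}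
    (hf1 : f 1 = 0) (hg1 : g 1 = 1) (hh1 : h 1 = 0) (hI : Indep f h)
    (hfe : ∀ x y, f (x * y) = f x * g y + g x * f y + h x * h y) :
    ∃ p q m r : ℂ,
      (∀ x y, h (x * y) = g x * h y + h x * g y + q * f x * f y + p * (f x * h y + h x * f y)
        + m * h x * h y) ∧
      (∀ x y, g (x * y) = g x * g y + r * f x * f y + q * (f x * h y + h x * f y)
        + p * h x * h y) := by
  -- The unit makes `g` independent of `f` and `h`; on a semigroup this could fail, hence the
  -- adjoined unit below.
  have hI3 : ∀ a b c : ℂ, (∀ x, a * f x + b * g x + c * h x = 0) → a = 0 ∧ b = 0 ∧ c = 0 := by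
    intro a b c H
    have hb : b = 0 := by simpa [hf1, hg1, hh1] using H 1
    subst hb
    obtain ⟨ha, hc⟩ := hI a c fun x => by linear_combination H x
    exact ⟨ha, rfl, hc⟩
  obtain ⟨s, t, hd⟩ := hI.exists_det_ne_zero
  have hassoc : ∀ x y z, f (x * y) * g z + g (x * y) * f z + h (x * y) * h z
      = f x * g (y * z) + g x * f (y * z) + h x * h (y * z) := by
    intro x y z
    rw [← hfe, ← hfe, mul_assoc]
  -- Solve `hassoc` at `z = s` and `z = t` for `g (x * y)` and `h (x * y)`.
  have hg : ∃ A B C : M → ℂ, ∀ x y, g (x * y) = f x * A y + g x * B y + h x * C y := by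
    refine ⟨fun y => ((g (y * s) - g y * g s) * h t - (g (y * t) - g y * g t) * h s) /
        (f s * h t - f t * h s),
      fun y => ((f (y * s) - f y * g s) * h t - (f (y * t) - f y * g t) * h s) /
        (f s * h t - f t * h s),
      fun y => ((h (y * s) - h y * g s) * h t - (h (y * t) - h y * g t) * h s) /
        (f s * h t - f t * h s), fun x y => ?_⟩
    simp only [mul_div_assoc']
    rw [← add_div, ← add_div, eq_div_iff hd]
    linear_combination h t * hassoc x y s - h s * hassoc x y t
      - (h t * g s - h s * g t) * hfe x y
  have hh : ∃ A B C : M → ℂ, ∀ x y, h (x * y) = f x * A y + g x * B y + h x * C y := by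
    refine ⟨fun y => ((g (y * t) - g y * g t) * f s - (g (y * s) - g y * g s) * f t) /
        (f s * h t - f t * h s),
      fun y => ((f (y * t) - f y * g t) * f s - (f (y * s) - f y * g s) * f t) /
        (f s * h t - f t * h s),
      fun y => ((h (y * t) - h y * g t) * f s - (h (y * s) - h y * g s) * f t) /
        (f s * h t - f t * h s), fun x y => ?_⟩
    simp only [mul_div_assoc']
    rw [← add_div, ← add_div, eq_div_iff hd]
    linear_combination f s * hassoc x y t - f t * hassoc x y s
      - (f s * g t - f t * g s) * hfe x y
  obtain ⟨A, B, C, hg⟩ := hg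
  obtain ⟨A', B', C', hh⟩ := hh
  -- Coefficients of `f x`, `g x`, `h x` in `hassoc`.
  have key : ∀ y z, g (y * z) - (g y * g z + A y * f z + A' y * h z) = 0 ∧
      f (y * z) - (f y * g z + B y * f z + B' y * h z) = 0 ∧
      h (y * z) - (h y * g z + C y * f z + C' y * h z) = 0 := fun y z =>
    hI3 _ _ _ fun x => by
      linear_combination -hassoc x y z + g z * hfe x y + f z * hg x y + h z * hh x y
  have hBB : ∀ y, B y - g y = 0 ∧ B' y - h y = 0 := fun y => hI _ _ fun z => by
    linear_combination hfe y z - (key y z).2.1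
  obtain ⟨r, q, p, hA, hA', hC⟩ := hI.exists_coeff (A := A) (B := A') (C := C) fun x y => by
    linear_combination (key x y).1 - hg x y - g x * (hBB y).1
  obtain ⟨q', p', m, hC2, -, hC'⟩ := hI.exists_coeff (A := C) (B := fun x => C' x - g x)
    (C := fun x => C' x - g x) fun x y => by
      linear_combination (key x y).2.2 - hh x y - g x * (hBB y).2 + f x * hC y - f x * hA' y
  obtain ⟨hqq, hpp⟩ := hI (q - q') (p - p') fun x => by linear_combination hC2 x - hC x
  refine ⟨p, q, m, r, fun x y => ?_, fun x y => ?_⟩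
  · linear_combination hh x y + f x * hA' y + g x * (hBB y).2 + h x * hC' y - h x * f y * hpp
  · linear_combination hg x y + f x * hA y + g x * (hBB y).1 + h x * hC y

/-- Extension of a function to the semigroup with a unit adjoined. -/
def extend {S : Type*} (a : ℂ) (f : S → ℂ) : WithOne S → ℂ := WithOne.recOneCoe a f

/-- A solution of the cosine-sine equation closes up under products. -/
theorem exists_structure_constants {S : Type*} [Semigroup S] {f g h : S → ℂ} (hI : Indep f h)
    (hfe : ∀ x y, f (x * y) = f x * g y + g x * f y + h x * h y) :
    ∃ p q m : ℂ,
      (∀ x y, h (x * y) = g x * h y + h x * g y + q * f x * f y + p * (f x * h y + h x * f y)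
        + m * h x * h y) ∧
      (∀ x y, g (x * y) = g x * g y + (p ^ 2 - q * m) * f x * f y + q * (f x * h y + h x * f y)
        + p * h x * h y) := by
  obtain ⟨p, q, m, r, h1, h2⟩ := exists_structure_constants_monoid (M := WithOne S)
    (f := extend 0 f) (g := extend 1 g) (h := extend 0 h) rfl rfl rfl
    (fun a b hab => hI a b fun x => hab x) (fun x y => by
      induction x using WithOne.recOneCoe with
      | one => rw [one_mul]; simp [extend]
      | coe x =>
        induction y using WithOne.recOneCoe with
        | one => rw [mul_one]; simp [extend]
        | coe y => exact hfe x y)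
  have hh : ∀ x y, h (x * y) = g x * h y + h x * g y + q * f x * f y
      + p * (f x * h y + h x * f y) + m * h x * h y := fun x y => h1 x y
  have hg : ∀ x y, g (x * y) = g x * g y + r * f x * f y + q * (f x * h y + h x * f y)
        + p * h x * h y := fun x y => h2 x y
  have hrel : r = p ^ 2 - q * m := by
    obtain ⟨s, t, hd⟩ := hI.exists_det_ne_zero
    have hs : ∃ z, f z ≠ 0 := by
      by_contra! hz
      simp [hz] at hd
    obtain ⟨z, hz⟩ := hs
    -- Associativity of `h` on the product `s * z * t` fixes `r`.
    have hxy : (r - (p ^ 2 - q * m)) * (f z * (f s * h t - f t * h s)) = 0 := by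
      have e1 := hh (s * z) t
      rw [mul_assoc, hh s (z * t), hfe s z, hfe z t, hg s z, hg z t, hh s z, hh z t] at e1
      linear_combination -e1
    exact sub_eq_zero.1 ((mul_eq_zero.1 hxy).resolve_right (mul_ne_zero hz hd))
  exact ⟨p, q, m, hh, fun x y => by rw [hg, hrel]⟩

variable {S : Type*} [Semigroup S]

theorem Indep.ne_zero_left {X : Type*} {u v : X → ℂ} (h : Indep u v) : u ≠ 0 := by
  rintro rfl
  exact one_ne_zero (h 1 0 fun x => by simp).1

theorem Indep.add_smul_ne_zero {X : Type*} {u v : X → ℂ} (h : Indep u v) (d : ℂ) :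
    v + d • u ≠ 0 := by
  intro h0
  exact one_ne_zero (h d 1 fun x => by
    have := congrFun h0 x
    simp only [Pi.add_apply, Pi.smul_apply, smul_eq_mul, Pi.zero_apply] at this
    linear_combination this).2

theorem isEven_iff {S : Type*} {σ : S → S} {u : S → ℂ} : IsEven σ u ↔ ∀ x, u (σ x) = u x := funext_iff

theorem isOdd_iff {S : Type*} {σ : S → S} {u : S → ℂ} : IsOdd σ u ↔ ∀ x, u (σ x) = -u x := funext_iff

theorem isEven_add_smul {S : Type*} {f h : S → ℂ} {σ : S → S} (hf : IsEven σ f) (hh : IsEven σ h) (d : ℂ) :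
    IsEven σ (h + d • f) := by
  rw [isEven_iff] at *
  intro x
  simp only [Pi.add_apply, Pi.smul_apply, hf, hh]

theorem isOdd_zero {S : Type*} (σ : S → S) : IsOdd σ 0 := isOdd_iff.2 fun x => by simp

theorem isAdditiveFor_zero (χ : S → ℂ) : IsAdditiveFor χ 0 := fun x y => by simp

/-! ### The cubic and its multiplicative functions -/

/-- The functional equation together with the product formulas for `g` and `h`, the structure
constants being parametrized by the three roots of the associated cubic. -/
structure HasRoots (f g h : S → ℂ) (t₁ t₂ t₃ : ℂ) : Prop where
  map_f : ∀ x y, f (x * y) = f x * g y + g x * f y + h x * h y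
  map_h : ∀ x y, h (x * y) = g x * h y + h x * g y + t₁ * t₂ * t₃ * f x * f y
    - (t₁ * t₂ + t₁ * t₃ + t₂ * t₃) / 2 * (f x * h y + h x * f y) + (t₁ + t₂ + t₃) * h x * h y
  map_g : ∀ x y, g (x * y) = g x * g y + ((t₁ * t₂ + t₁ * t₃ + t₂ * t₃) ^ 2 / 4
      - t₁ * t₂ * t₃ * (t₁ + t₂ + t₃)) * f x * f y
    + t₁ * t₂ * t₃ * (f x * h y + h x * f y) - (t₁ * t₂ + t₁ * t₃ + t₂ * t₃) / 2 * h x * h y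

theorem exists_roots (a b c : ℂ) :
    ∃ t₁ t₂ t₃ : ℂ, t₁ + t₂ + t₃ = a ∧ t₁ * t₂ + t₁ * t₃ + t₂ * t₃ = b ∧ t₁ * t₂ * t₃ = c := by
  obtain ⟨t₁, h1⟩ : ∃ t : ℂ, t ^ 3 - a * t ^ 2 + b * t - c = 0 := by
    have hdeg : (Cubic.mk 1 (-a) b (-c)).toPoly.degree ≠ 0 := by
      rw [Cubic.degree_of_a_ne_zero (by simp)]; decide
    obtain ⟨t, ht⟩ := IsAlgClosed.exists_root _ hdeg
    refine ⟨t, ?_⟩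
    simp [Cubic.toPoly, Polynomial.IsRoot] at ht
    linear_combination ht
  -- `w` is a square root of the discriminant of the quadratic left after dividing by `T - t₁`.
  obtain ⟨w, hw⟩ := IsAlgClosed.exists_pow_nat_eq
    ((a - t₁) ^ 2 - 4 * (b - t₁ * (a - t₁))) (n := 2) two_pos
  refine ⟨t₁, (a - t₁ + w) / 2, (a - t₁ - w) / 2, by ring, ?_, ?_⟩
  · linear_combination (-1 / 4) * hw
  · linear_combination (-t₁ / 4) * hw + h1

/-- Multiplicativity of `g + t h + λ f` follows from `λ = t² - m t - p` and `t λ = q + p t`;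
eliminating `λ` gives the cubic with symmetric functions `m`, `-2p`, `q`. -/
theorem exists_hasRoots {f g h : S → ℂ} (hI : Indep f h)
    (hfe : ∀ x y, f (x * y) = f x * g y + g x * f y + h x * h y) :
    ∃ t₁ t₂ t₃ : ℂ, HasRoots f g h t₁ t₂ t₃ := by
  obtain ⟨p, q, m, hh, hg⟩ := exists_structure_constants hI hfe
  obtain ⟨t₁, t₂, t₃, h1, h2, h3⟩ := exists_roots m (-2 * p) q
  refine ⟨t₁, t₂, t₃, hfe, fun x y => ?_, fun x y => ?_⟩
  · rw [h1, h2, h3, hh]; ring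
  · rw [h1, h2, h3, hg]; ring

namespace HasRoots

variable {f g h : S → ℂ} {t₁ t₂ t₃ : ℂ}

theorem perm (H : HasRoots f g h t₁ t₂ t₃) : HasRoots f g h t₂ t₃ t₁ where
  map_f := H.map_f
  map_h x y := by rw [H.map_h]; ring
  map_g x y := by rw [H.map_g]; ring

theorem swap (H : HasRoots f g h t₁ t₂ t₃) : HasRoots f g h t₂ t₁ t₃ where
  map_f := H.map_f
  map_h x y := by rw [H.map_h]; ring
  map_g x y := by rw [H.map_g]; ring

/-- The multiplicative function belonging to the root `t₁`. -/
noncomputable def char {S : Type*} (f g h : S → ℂ) (t₁ t₂ t₃ : ℂ) : S → ℂ :=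
  ((t₂ * t₃ - t₁ * t₂ - t₁ * t₃) / 2) • f + t₁ • h + g

theorem isMultiplicative_char (H : HasRoots f g h t₁ t₂ t₃) :
    IsMultiplicative (char f g h t₁ t₂ t₃) := by
  intro x y
  simp only [char, Pi.add_apply, Pi.smul_apply, smul_eq_mul, H.map_f, H.map_g, H.map_h]
  ring

theorem isEven_char {S : Type*} {f g h : S → ℂ} {σ : S → S} (hf : IsEven σ f) (hg : IsEven σ g)
    (hh : IsEven σ h) : IsEven σ (char f g h t₁ t₂ t₃) := by
  rw [isEven_iff] at *
  intro x
  simp only [char, Pi.add_apply, Pi.smul_apply, smul_eq_mul, hf, hg, hh]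

theorem char_sub_char {S : Type*} {f g h : S → ℂ} :
    char f g h t₁ t₂ t₃ - char f g h t₂ t₁ t₃ = (t₁ - t₂) • (h + (-t₃) • f) := by
  ext x
  simp only [char, Pi.add_apply, Pi.sub_apply, Pi.smul_apply, smul_eq_mul]
  ring

theorem char_ne_char {S : Type*} {f g h : S → ℂ} (hI : Indep f h) (h12 : t₁ ≠ t₂) :
    char f g h t₁ t₂ t₃ ≠ char f g h t₂ t₁ t₃ := by
  rw [← sub_ne_zero, char_sub_char]
  exact smul_ne_zero (sub_ne_zero.2 h12) (hI.add_smul_ne_zero _)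

theorem char_swap {S : Type*} {f g h : S → ℂ} :
    char f g h t₁ t₃ t₂ = char f g h t₁ t₂ t₃ := by
  ext x
  simp only [char, Pi.add_apply, Pi.smul_apply, smul_eq_mul]
  ring

/-- By `char_sub_char`, `h - t₃ f` is the difference quotient of the multiplicative functions of
`t₁` and `t₂`; at a double root it becomes a derivative. -/
theorem isAdditiveFor_char (H : HasRoots f g h t₁ t₁ t₃) :
    IsAdditiveFor (char f g h t₁ t₁ t₃) (h + (-t₃) • f) := by
  intro x y
  simp only [char, Pi.add_apply, Pi.smul_apply, smul_eq_mul, H.map_f, H.map_h]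
  ring

/-- The shift `δ = -t₃` is chosen because `h - t₃ f` is proportional to `χ₁ - χ₂`, as (D) demands.
-/
theorem familyE_of_ne {σ : S → S} (H : HasRoots f g h t₁ t₂ t₃) (hI : Indep f h)
    (hf : IsEven σ f) (hg : IsEven σ g) (hh : IsEven σ h)
    (h12 : t₁ ≠ t₂) (h13 : t₁ ≠ t₃) (h23 : t₂ ≠ t₃) : FamilyE σ f g h := by
  have e12 := sub_ne_zero.2 h12
  have e13 := sub_ne_zero.2 h13
  have e23 := sub_ne_zero.2 h23
  have e31 := sub_ne_zero.2 h13.symm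
  have e32 := sub_ne_zero.2 h23.symm
  refine ⟨f, g + t₃ • h + (-(t₃ ^ 2 / 2)) • f, h + (-t₃) • f, -t₃, Or.inr (Or.inr (Or.inr
    ⟨char f g h t₁ t₂ t₃, char f g h t₂ t₁ t₃, char f g h t₃ t₁ t₂,
    -1 / (2 * (t₃ - t₁) * (t₃ - t₂)), (t₁ - t₂) / 2, 2 * (t₃ - t₂) / (t₁ - t₂),
    H.isMultiplicative_char, isEven_char hf hg hh, H.swap.isMultiplicative_char,
    isEven_char hf hg hh, H.perm.perm.isMultiplicative_char, isEven_char hf hg hh,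
    char_ne_char hI h12, ?_, ?_, ?_, ?_, ?_, ?_, ?_, ?_, ?_⟩)), rfl, ?_, ?_⟩
  · rw [← char_swap]
    exact char_ne_char hI h13
  · rw [← char_swap, ← char_swap (t₁ := t₃)]
    exact char_ne_char hI h23
  · exact div_ne_zero (by simp) (mul_ne_zero (mul_ne_zero two_ne_zero e31) e32)
  · exact div_ne_zero e12 two_ne_zero
  · exact div_ne_zero (mul_ne_zero two_ne_zero e32) e12
  · field_simp
    ring
  · ext x
    simp only [char, Pi.add_apply, Pi.sub_apply, Pi.smul_apply, smul_eq_mul]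
    field_simp
    ring
  · ext x
    simp only [char, Pi.add_apply, Pi.smul_apply, smul_eq_mul]
    field_simp
    ring
  · ext x
    simp only [char, Pi.add_apply, Pi.sub_apply, Pi.smul_apply, smul_eq_mul]
    field_simp
    ring
  · ext x
    simp only [Pi.add_apply, Pi.smul_apply, smul_eq_mul]
    ring
  · ext x
    simp only [Pi.add_apply, Pi.smul_apply, smul_eq_mul]
    ring

/-- Here `h - t₁ f` is proportional to the difference of the two multiplicative functions, while `h
- t₃ f` is the additive one. If the function of the double root is zero, `g` is a combination of `f`
and `h`. -/
theorem familyE_or_familyG_of_double {σ : S → S} (H : HasRoots f g h t₁ t₁ t₃)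
    (hI : Indep f h) (hf : IsEven σ f) (hg : IsEven σ g) (hh : IsEven σ h) (h13 : t₁ ≠ t₃) :
    FamilyE σ f g h ∨ FamilyG σ f g h := by
  have e31 := sub_ne_zero.2 h13.symm
  have hc : 1 / (t₃ - t₁) ≠ 0 := one_div_ne_zero e31
  have hne : char f g h t₁ t₁ t₃ ≠ char f g h t₃ t₁ t₁ := by
    rw [← char_swap]
    exact char_ne_char hI h13
  by_cases hχ : char f g h t₁ t₁ t₃ = 0
  · right
    have hadd := H.isAdditiveFor_char
    rw [hχ] at hadd hne
    have hg' : ∀ x, g x = -((t₁ * t₃ - t₁ * t₁ - t₁ * t₃) / 2 * f x + t₁ * h x) := fun x => by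
      have := congrFun hχ x
      simp only [char, Pi.add_apply, Pi.smul_apply, smul_eq_mul, Pi.zero_apply] at this
      linear_combination this
    refine ⟨char f g h t₃ t₁ t₁, h + (-t₃) • f, 0, 1 / (t₃ - t₁), -t₁,
      H.perm.perm.isMultiplicative_char, isEven_char hf hg hh, hne.symm, hadd,
      isEven_add_smul hf hh _, hI.add_smul_ne_zero _, isAdditiveFor_zero _, isOdd_zero _, hc,
      ?_, ?_, ?_⟩ <;>
    · ext x
      simp only [char, Pi.add_apply, Pi.sub_apply, Pi.smul_apply, smul_eq_mul, Pi.zero_apply, hg']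
      field_simp
      ring
  · left
    refine ⟨f, g + t₁ • h + (-(t₁ ^ 2 / 2)) • f, h + (-t₁) • f, -t₁, Or.inr (Or.inl
      ⟨char f g h t₃ t₁ t₁, char f g h t₁ t₁ t₃, h + (-t₃) • f, 1 / (t₃ - t₁),
      H.perm.perm.isMultiplicative_char, isEven_char hf hg hh, H.isMultiplicative_char,
      isEven_char hf hg hh, hχ, hne, H.isAdditiveFor_char, isEven_add_smul hf hh _,
      hI.add_smul_ne_zero _, hc, ?_, ?_, ?_⟩), rfl, ?_, ?_⟩ <;>
    · ext x
      simp only [char, Pi.add_apply, Pi.sub_apply, Pi.smul_apply, smul_eq_mul]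
      field_simp
      ring

theorem familyE_or_familyF_of_triple {σ : S → S} (H : HasRoots f g h t₁ t₁ t₁)
    (hI : Indep f h) (hf : IsEven σ f) (hg : IsEven σ g) (hh : IsEven σ h) :
    FamilyE σ f g h ∨ FamilyF σ f g h := by
  have hadd := H.isAdditiveFor_char
  have hψ : ∀ x y, f (x * y) = f x * char f g h t₁ t₁ t₁ y + char f g h t₁ t₁ t₁ x * f y +
      (h + (-t₁) • f) x * (h + (-t₁) • f) y := fun x y => by
    simp only [char, Pi.add_apply, Pi.smul_apply, smul_eq_mul, H.map_f]
    ring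
  by_cases hχ : char f g h t₁ t₁ t₁ = 0
  · right
    have hg' : ∀ x, g x = -((t₁ * t₁ - t₁ * t₁ - t₁ * t₁) / 2 * f x + t₁ * h x) := fun x => by
      have := congrFun hχ x
      simp only [char, Pi.add_apply, Pi.smul_apply, smul_eq_mul, Pi.zero_apply] at this
      linear_combination this
    have hΦ := isEven_add_smul hf hh (-t₁)
    rw [hχ] at hadd hψ
    refine ⟨h + (-t₁) • f, f, 0, -t₁, hadd, hI.add_smul_ne_zero _, ⟨hadd, fun x y => ?_⟩,
      hI.ne_zero_left, isAdditiveFor_zero _, isOdd_zero _, Or.inl ⟨hΦ, hf⟩, ?_, ?_, ?_⟩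
    · rw [hψ x (σ y), isEven_iff.1 hΦ y]
      simp
    all_goals
      ext x
      simp only [Pi.add_apply, Pi.smul_apply, smul_eq_mul, Pi.zero_apply, hg']
      ring
  · left
    refine ⟨f, char f g h t₁ t₁ t₁, h + (-t₁) • f, -t₁, Or.inl
      ⟨char f g h t₁ t₁ t₁, h + (-t₁) • f, f, H.isMultiplicative_char,
      isEven_char hf hg hh, hχ, hadd, isEven_add_smul hf hh _, hI.add_smul_ne_zero _,
      ⟨hadd, hψ⟩, hf, hI.ne_zero_left, rfl, rfl, rfl⟩, rfl, ?_, ?_⟩ <;>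
    · ext x
      simp only [char, Pi.add_apply, Pi.smul_apply, smul_eq_mul]
      ring

end HasRoots

/-- Classification of the solutions all of whose components are even. -/
theorem classification_of_isEven {σ : S → S} {f g h : S → ℂ} (hs : IsSolution σ f g h)
    (hσ : ∀ x, σ (σ x) = x) (hI : Indep f h)
    (hf : IsEven σ f) (hg : IsEven σ g) (hh : IsEven σ h) :
    FamilyE σ f g h ∨ FamilyF σ f g h ∨ FamilyG σ f g h := by
  obtain ⟨t₁, t₂, t₃, H⟩ := exists_hasRoots (f := f) (g := g) (h := h) hI fun x y => by
    have := hs x (σ y)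
    rwa [hσ, isEven_iff.1 hf, isEven_iff.1 hg, isEven_iff.1 hh] at this
  by_cases h12 : t₁ = t₂
  · subst h12
    by_cases h13 : t₁ = t₃
    · subst h13
      have := H.familyE_or_familyF_of_triple hI hf hg hh
      tauto
    · have := H.familyE_or_familyG_of_double hI hf hg hh h13
      tauto
  · by_cases h13 : t₁ = t₃
    · subst h13
      have := H.perm.perm.familyE_or_familyG_of_double hI hf hg hh h12
      tauto
    · by_cases h23 : t₂ = t₃
      · subst h23
        have := H.perm.familyE_or_familyG_of_double hI hf hg hh (Ne.symm h12)
        tauto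
      · exact Or.inl (H.familyE_of_ne hI hf hg hh h12 h13 h23)

/-! ### Even and odd parts -/

/-- The odd part `(f - f*) / 2`. -/
noncomputable def oddPart {S : Type*} (σ : S → S) (f : S → ℂ) : S → ℂ :=
  fun x => (f x - f (σ x)) / 2

/-- The properties of the even and odd parts of a solution on which the classification rests. -/
structure ParityData (σ : S → S) (fe fo ge go he ho : S → ℂ) :
    Prop where
  fe_even : ∀ x, fe (σ x) = fe x
  fo_odd : ∀ x, fo (σ x) = -fo x
  ge_even : ∀ x, ge (σ x) = ge x
  go_odd : ∀ x, go (σ x) = -go x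
  he_even : ∀ x, he (σ x) = he x
  ho_odd : ∀ x, ho (σ x) = -ho x
  fe_mul : ∀ x y, fe (x * y) = fe x * ge y - fo x * go y + ge x * fe y - go x * fo y
    + he x * he y - ho x * ho y
  fo_mul : ∀ x y, fo (x * y) = fo x * ge y - fe x * go y - ge x * fo y + go x * fe y
    - he x * ho y + ho x * he y
  fo_mul_mul : ∀ x y z, fo (x * (y * z)) = 0

theorem IsSolution.parityData {σ : S ≃* S} (hσ : ∀ x, σ (σ x) = x) {f g h : S → ℂ}
    (hs : IsSolution σ f g h) :
    ParityData σ (evenPart σ f) (oddPart σ f) (evenPart σ g) (oddPart σ g) (evenPart σ h)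
      (oddPart σ h) := by
  have hmul : ∀ x y, f (x * y) = f x * g (σ y) + g x * f (σ y) + h x * h (σ y) := fun x y => by
    rw [← hs, hσ]
  have hsymm : ∀ x y, f (x * y) = f (σ (y * x)) := fun x y => by
    rw [map_mul, hs, hmul]; ring
  refine ⟨?_, ?_, ?_, ?_, ?_, ?_, fun x y => ?_, fun x y => ?_, fun x y z => ?_⟩
  iterate 6
    intro x
    simp only [evenPart, oddPart, hσ]
    ring
  · simp only [evenPart, oddPart, map_mul, hmul, hσ]
    ring
  · simp only [evenPart, oddPart, map_mul, hmul, hσ]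
    ring
  · have h1 : f (x * (y * z)) = f (y * (z * x)) := by
      rw [← mul_assoc, hsymm, ← mul_assoc, ← hsymm]
    have h2 : f (y * (z * x)) = f (σ (x * (y * z))) := by
      rw [← mul_assoc, hsymm]
    simp only [oddPart]
    rw [h1, h2, sub_self, zero_div]

namespace ParityData

variable {σ : S → S} {fe fo ge go he ho : S → ℂ}

/-- `fo` vanishes on `x * (y * z)` and on `σ x * (y * z)`; the half sum keeps the terms even in `x`,
the half difference (`odd_left`) the odd ones. -/
theorem even_left (P : ParityData σ fe fo ge go he ho) (x y z : S) :
    fe x * go (y * z) + ge x * fo (y * z) + he x * ho (y * z) = 0 := by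
  have h1 := P.fo_mul x (y * z)
  have h2 := P.fo_mul (σ x) (y * z)
  rw [P.fo_mul_mul] at h1 h2
  rw [P.fe_even, P.fo_odd, P.ge_even, P.go_odd, P.he_even, P.ho_odd] at h2
  linear_combination (h1 + h2) / 2

theorem odd_left (P : ParityData σ fe fo ge go he ho) (x y z : S) :
    fo x * ge (y * z) + go x * fe (y * z) + ho x * he (y * z) = 0 := by
  have h1 := P.fo_mul x (y * z)
  have h2 := P.fo_mul (σ x) (y * z)
  rw [P.fo_mul_mul] at h1 h2
  rw [P.fe_even, P.fo_odd, P.ge_even, P.go_odd, P.he_even, P.ho_odd] at h2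
  linear_combination (h2 - h1) / 2

/-- If the even parts are linearly independent, the odd parts vanish. -/
theorem odd_eq_zero (P : ParityData σ fe fo ge go he ho)
    (hI : ∀ a b c : ℂ, (∀ x, a * fe x + b * ge x + c * he x = 0) → a = 0 ∧ b = 0 ∧ c = 0)
    (y : S) : fo y = 0 ∧ go y = 0 ∧ ho y = 0 := by
  have hfo : ∀ x y, fo (x * y) = 0 := fun y z =>
    (hI (go (y * z)) (fo (y * z)) (ho (y * z)) fun x => by
      linear_combination P.even_left x y z).2.1
  obtain ⟨h1, h2, h3⟩ := hI (go y) (fo y) (ho y) fun x => by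
    have h1 := P.fo_mul x y
    have h2 := P.fo_mul (σ x) y
    rw [hfo] at h1 h2
    rw [P.fe_even, P.fo_odd, P.ge_even, P.go_odd, P.he_even, P.ho_odd] at h2
    linear_combination (h1 + h2) / 2
  exact ⟨h2, h1, h3⟩

section proportional

variable {a : ℂ}

theorem exists_fe_mul_ne_zero (P : ParityData σ fe fo (fun x => a * fe x) go he ho)
    (hI : Indep fe he) : ∃ y z, fe (y * z) ≠ 0 := by
  by_contra! h0
  have key : ∀ x y, 2 * a * fe y * fe x + he y * he x = 0 := fun x y => by
    have h1 := P.fe_mul x y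
    have h2 := P.fe_mul (σ x) y
    rw [h0] at h1 h2
    simp only [P.fe_even, P.fo_odd, P.go_odd, P.he_even, P.ho_odd] at h2
    linear_combination -(h1 + h2) / 2
  have h2 : ∀ y, he y = 0 := fun y => (hI _ _ fun x => key x y).2
  exact one_ne_zero (hI 0 1 fun x => by simp [h2]).2

/-- The case in which `ge` is a multiple of `fe` and `ho` vanishes. -/
theorem of_ho_eq_zero (P : ParityData σ fe fo (fun x => a * fe x) go he ho)
    (hI : Indep fe he) (hho : ∀ x, ho x = 0) :
    (∀ x, go x = -a * fo x) ∧ (∀ x y, fo (x * y) = 0) ∧ (a = 0 ∨ ∀ x, fo x = 0) := by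
  obtain ⟨y, z, hyz⟩ := P.exists_fe_mul_ne_zero hI
  have hgo : ∀ x, go x = -a * fo x := fun x => by
    have h1 := P.odd_left x y z
    rw [hho] at h1
    have : (go x + a * fo x) * fe (y * z) = 0 := by linear_combination h1
    linear_combination (mul_eq_zero.1 this).resolve_right hyz
  have hfo : ∀ x y, fo (x * y) = 0 := fun x y => by
    rw [P.fo_mul, hho, hho, hgo, hgo]
    ring
  refine ⟨hgo, hfo, ?_⟩
  have hfe : ∀ x y, fe (x * y) = 2 * a * (fe x * fe y + fo x * fo y) + he x * he y :=
    fun x y => by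
      rw [P.fe_mul, hho, hho, hgo, hgo]
      ring
  -- As `fo` is zero on products, `fe ((x * y) * z)` is unchanged under `z ↦ σ z`. In `fe (x * (y *
  -- z))` the term with `fo y * fo z` changes sign.
  have key : ∀ y z, 4 * a ^ 2 * fo y * fo z = 0 := fun y z => by
    refine (hI (4 * a ^ 2 * fo y * fo z) ((he (y * z) - he (y * σ z)) / 2) fun x => ?_).1
    have h1 := hfe (x * y) z
    have h2 := hfe (x * y) (σ z)
    rw [mul_assoc, hfe x, hfe y, hfo, hfo] at h1 h2
    rw [P.fe_even, P.fo_odd, P.he_even] at h2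
    linear_combination (h1 - h2) / 2
  by_cases ha : a = 0
  · exact Or.inl ha
  · right
    intro x
    simpa [ha] using key x x

/-- The case in which `ge` is a multiple of `fe` and `ho` does not vanish. -/
theorem of_ho_ne_zero (P : ParityData σ fe fo (fun x => a * fe x) go he ho)
    (hI : Indep fe he) {w : S} (hw : ho w ≠ 0) :
    a = 0 ∧ (∀ x, go x = 0) ∧ (∀ x y, he (x * y) = 0) ∧ ∀ x y, ho (x * y) = 0 := by
  obtain ⟨y, z, hyz⟩ := P.exists_fe_mul_ne_zero hI
  obtain ⟨s, hs⟩ : ∃ s : ℂ, ∀ x, go x = s * ho x - a * fo x := by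
    refine ⟨-he (y * z) / fe (y * z), fun x => ?_⟩
    have := P.odd_left x y z
    field_simp
    linear_combination this
  have hH : ∀ x y, he (x * y) = -s * fe (x * y) := fun x y => by
    have h1 := P.odd_left w x y
    rw [hs] at h1
    have : (he (x * y) + s * fe (x * y)) * ho w = 0 := by linear_combination h1
    linear_combination (mul_eq_zero.1 this).resolve_right hw
  have hho : ∀ x y, ho (x * y) = 0 := fun y z =>
    (hI (go (y * z) + a * fo (y * z)) (ho (y * z)) fun x => by
      linear_combination P.even_left x y z).2
  -- `H = he + s fe` is even, vanishes on products, and replaces `he` in the independent pair.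
  obtain ⟨H, hHdef⟩ : ∃ H : S → ℂ, ∀ x, he x = H x - s * fe x :=
    ⟨fun x => he x + s * fe x, fun x => by ring⟩
  have hHmul : ∀ x y, H (x * y) = 0 := fun x y => by
    linear_combination hH x y - hHdef (x * y)
  have hHe : ∀ x, H (σ x) = H x := fun x => by
    linear_combination P.he_even x - hHdef (σ x) + hHdef x + s * P.fe_even x
  have hI' : Indep fe H := fun c d hcd => by
    obtain ⟨h1, h2⟩ := hI (c + d * s) d fun x => by linear_combination hcd x + d * hHdef x
    exact ⟨by rw [h2] at h1; simpa using h1, h2⟩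
  have hfo : ∀ x y, fo (x * y) = ho x * H y - H x * ho y := fun x y => by
    rw [P.fo_mul, hs, hs, hHdef, hHdef]
    ring
  have hfe : ∀ x y, fe (x * y) = (2 * a + s ^ 2) * fe x * fe y + 2 * a * fo x * fo y
      - s * (fo x * ho y + ho x * fo y) + H x * H y - s * (H x * fe y + fe x * H y)
      - ho x * ho y := fun x y => by
    rw [P.fe_mul, hs, hs, hHdef, hHdef]
    ring
  -- Associativity of `fe`, averaged over `x` and `σ x`: the coefficients of `fe x` and `H x`.
  have key : ∀ y z, (2 * a + s ^ 2) * fe (y * z) - ((2 * a + s ^ 2) * fe y - s * H y) *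
        ((2 * a + s ^ 2) * fe z - s * H z) = 0 ∧
      -s * fe (y * z) - (H y - s * fe y) * ((2 * a + s ^ 2) * fe z - s * H z)
        + ho y * (2 * a * fo z - s * ho z) = 0 := fun y z => hI' _ _ fun x => by
    have h1 := hfe x (y * z)
    have h2 := hfe (σ x) (y * z)
    rw [← mul_assoc, hfe (x * y) z, hfe x y, hfo x y, hHmul, hHmul, hho, hho] at h1
    rw [← mul_assoc, hfe (σ x * y) z, hfe (σ x) y, hfo (σ x) y, hHmul, hHmul, hho, hho,
      P.fe_even, P.fo_odd, P.ho_odd, hHe] at h2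
    linear_combination -(h1 + h2) / 2
  -- Separate the parts that are even and odd in `y`.
  have key1 : ∀ y z, a * H y * H z = 0 := fun y z => by
    have h1 := (key y z).1
    have h2 := (key (σ y) z).1
    rw [hfe] at h1 h2
    rw [P.fe_even, P.fo_odd, P.ho_odd, hHe] at h2
    linear_combination (h1 + h2) / 4
  have ha : a = 0 := by
    by_contra ha
    have : ∀ y, H y = 0 := fun y => by simpa [ha] using key1 y y
    exact one_ne_zero (hI' 0 1 fun x => by simp [this]).2
  subst ha
  have key2 : ∀ y z, s ^ 2 * (s * (fo y * ho z + ho y * fo z) + ho y * ho z) = 0 :=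
    fun y z => by
      have h1 := (key y z).1
      have h2 := (key (σ y) z).1
      rw [hfe] at h1 h2
      rw [P.fe_even, P.fo_odd, P.ho_odd, hHe] at h2
      linear_combination (h2 - h1) / 2
  have key3 : ∀ y z, s ^ 2 * (fo y * ho z + ho y * fo z) = 0 := fun y z => by
    have h1 := (key y z).2
    have h2 := (key (σ y) z).2
    rw [hfe] at h1 h2
    rw [P.fe_even, P.fo_odd, P.ho_odd, hHe] at h2
    linear_combination (h1 - h2) / 2
  have hs0 : s = 0 := by
    have : s ^ 2 * (ho w * ho w) = 0 := by linear_combination key2 w w - s * key3 w w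
    simpa [hw] using this
  subst hs0
  exact ⟨rfl, fun x => by rw [hs]; ring, fun x y => by rw [hH]; ring, hho⟩

end proportional

end ParityData

theorem evenPart_add_oddPart {S : Type*} (σ : S → S) (f : S → ℂ) (x : S) :
    f x = evenPart σ f x + oddPart σ f x := by
  simp only [evenPart, oddPart]
  ring

theorem isEven_of_oddPart {S : Type*} {σ : S → S} {f : S → ℂ} (h : ∀ x, oddPart σ f x = 0) :
    IsEven σ f := isEven_iff.2 fun x => by
  have := h x
  simp only [oddPart] at this
  linear_combination -2 * this

theorem evenPart_of_isEven {S : Type*} {σ : S → S} {f : S → ℂ} (h : IsEven σ f) :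
    evenPart σ f = f := by
  ext x
  simp only [evenPart, isEven_iff.1 h]
  ring

/-! ### Reduction to even solutions and the degenerate families -/

/-- If `h x * h y` depends on `x * y` only, then `h` is multiplicative up to a scalar. -/
theorem exists_mul_eq_smul {h u : S → ℂ} (hu : ∀ x y, u (x * y) = h x * h y) :
    ∃ t : ℂ, ∀ x y, h (x * y) = t * h x * h y := by
  by_cases h0 : ∃ z, h z ≠ 0
  · obtain ⟨z, hz⟩ := h0
    have hassoc : ∀ x y z, h x * h (y * z) = h (x * y) * h z := fun x y z => by
      rw [← hu, ← hu, mul_assoc]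
    refine ⟨h (z * z) / h z ^ 2, fun x y => ?_⟩
    field_simp
    linear_combination -(h z) * hassoc x y z - h x * hassoc y z z
  · push Not at h0
    exact ⟨0, fun x y => by simp [h0]⟩

/-- The reduction by `δ` of a solution is a solution. -/
theorem IsSolution.shift {σ : S → S} {f g h : S → ℂ} (hs : IsSolution σ f g h) (δ : ℂ) :
    IsSolution σ f (g + (-δ) • h + (-(δ ^ 2 / 2)) • f) (h + δ • f) := by
  intro x y
  simp only [Pi.add_apply, Pi.smul_apply, smul_eq_mul, hs x y]
  ring

/-- Solutions with vanishing `g` and even `h` after the reduction by `δ`. -/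
theorem familyF_or_familyG {σ : S → S} {f h₀ : S → ℂ} (δ : ℂ)
    (hσ : ∀ x, σ (σ x) = x) (hmul : ∀ x y, evenPart σ f (x * y) = h₀ x * h₀ y)
    (hodd : ∀ x y, oddPart σ f (x * y) = 0) (hh : IsEven σ h₀) (hI : Indep (evenPart σ f) h₀) :
    FamilyF σ f (δ • h₀ + (-(δ ^ 2 / 2)) • f) (h₀ + (-δ) • f) ∨
      FamilyG σ f (δ • h₀ + (-(δ ^ 2 / 2)) • f) (h₀ + (-δ) • f) := by
  have hh0 : h₀ ≠ 0 := by simpa using hI.add_smul_ne_zero 0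
  have hfe : IsEven σ (evenPart σ f) := isEven_iff.2 fun x => by
    simp only [evenPart, hσ]; ring
  have hfo : IsOdd σ (oddPart σ f) := isOdd_iff.2 fun x => by
    simp only [oddPart, hσ]; ring
  have hk : IsAdditiveFor 0 (oddPart σ f) := fun x y => by simp [hodd]
  obtain ⟨t, ht⟩ := exists_mul_eq_smul hmul
  by_cases ht0 : t = 0
  · left
    have hadd : IsAdditiveFor 0 h₀ := fun x y => by simp [ht, ht0]
    refine ⟨h₀, evenPart σ f, oddPart σ f, δ, hadd, hh0, ⟨hadd, fun x y => ?_⟩, hI.ne_zero_left,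
      hk, hfo, Or.inl ⟨hh, hfe⟩, ?_, ?_, ?_⟩
    · rw [hmul, isEven_iff.1 hh]
      simp
    all_goals
      ext x
      simp only [Pi.add_apply, Pi.smul_apply, smul_eq_mul, evenPart, oddPart]
      ring
  · right
    -- `Φ₀ = h₀ - t fᵉ` vanishes on products, since `h₀` there equals `t` times `fᵉ`.
    refine ⟨t • h₀, (1 / t) • (t • h₀) + (-t) • evenPart σ f, oddPart σ f, 1 / t, δ,
      fun x y => ?_, isEven_iff.2 fun x => ?_, smul_ne_zero ht0 hh0, fun x y => ?_,
      isEven_iff.2 fun x => ?_, ?_, hk, hfo, one_div_ne_zero ht0, ?_, ?_, ?_⟩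
    · simp only [Pi.smul_apply, smul_eq_mul, ht]
      ring
    · simp only [Pi.smul_apply, isEven_iff.1 hh]
    · simp only [Pi.add_apply, Pi.smul_apply, smul_eq_mul, ht, hmul, Pi.zero_apply]
      field_simp
      ring
    · simp only [Pi.add_apply, Pi.smul_apply, isEven_iff.1 hh, isEven_iff.1 hfe]
    · rw [smul_smul, one_div_mul_cancel ht0, one_smul]
      exact hI.add_smul_ne_zero _
    all_goals
      ext x
      simp only [Pi.add_apply, Pi.sub_apply, Pi.smul_apply, smul_eq_mul, evenPart, oddPart]
      field_simp
      ring

theorem classification {σ : S ≃* S} (hσ : ∀ x, σ (σ x) = x) {f g h : S → ℂ}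
    (hs : IsSolution σ f g h) (hI : Indep (evenPart σ f) (evenPart σ h)) :
    FamilyE σ f g h ∨ FamilyF σ f g h ∨ FamilyG σ f g h := by
  have even_case : IsEven σ f → IsEven σ g → IsEven σ h →
      FamilyE σ f g h ∨ FamilyF σ f g h ∨ FamilyG σ f g h := fun hf hg hh => by
    rw [evenPart_of_isEven hf, evenPart_of_isEven hh] at hI
    exact classification_of_isEven hs hσ hI hf hg hh
  by_cases hdep : ∃ a b : ℂ, ∀ x, evenPart σ g x = a * evenPart σ f x + b * evenPart σ h x
  · obtain ⟨a₀, δ, hge⟩ := hdep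
    have hs' := hs.shift δ
    obtain ⟨g₀, hg₀⟩ : ∃ g₀, g₀ = g + (-δ) • h + (-(δ ^ 2 / 2)) • f := ⟨_, rfl⟩
    obtain ⟨h₀, hh₀⟩ : ∃ h₀, h₀ = h + δ • f := ⟨_, rfl⟩
    rw [← hg₀, ← hh₀] at hs'
    have hh_eq : h = h₀ + (-δ) • f := by rw [hh₀]; module
    have hg_eq : g = g₀ + (δ • h₀ + (-(δ ^ 2 / 2)) • f) := by rw [hg₀, hh₀]; module
    have hI' : Indep (evenPart σ f) (evenPart σ h₀) := by
      convert hI.add_smul_left δ using 2 with x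
      simp only [hh₀, evenPart, Pi.add_apply, Pi.smul_apply, smul_eq_mul]
      ring
    obtain ⟨a, hga⟩ : ∃ a : ℂ, evenPart σ g₀ = fun x => a * evenPart σ f x := by
      -- The shift by the coefficient `δ` of `hᵉ` cancels that term and lowers the coefficient of
      -- `fᵉ` by `δ ^ 2 / 2`.
      refine ⟨a₀ - δ ^ 2 / 2, funext fun x => ?_⟩
      have := hge x
      simp only [hg₀, evenPart, Pi.add_apply, Pi.smul_apply, smul_eq_mul] at this ⊢
      linear_combination this
    have P := hs'.parityData hσ
    rw [hga] at P
    have g₀_eq_zero : a = 0 → (∀ x, oddPart σ g₀ x = 0) → g₀ = 0 := fun ha hgo => by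
      ext x
      rw [evenPart_add_oddPart σ g₀ x, hgo, hga, ha]
      simp
    by_cases hho : ∀ x, oddPart σ h₀ x = 0
    · obtain ⟨hgo, hfo, hcases⟩ := P.of_ho_eq_zero hI' hho
      have hhe := isEven_of_oddPart hho
      rcases hcases with ha | hf
      · have hgo' : ∀ x, oddPart σ g₀ x = 0 := fun x => by rw [hgo, ha]; ring
        have hfe : ∀ x y, evenPart σ f (x * y) = h₀ x * h₀ y := fun x y => by
          rw [P.fe_mul, hho, hho, hgo', hgo', ha, evenPart_of_isEven hhe]
          ring
        rw [evenPart_of_isEven hhe] at hI'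
        rw [hg_eq, g₀_eq_zero ha hgo', zero_add, hh_eq]
        exact Or.inr (familyF_or_familyG δ hσ hfe hfo hhe hI')
      · have hfe := isEven_of_oddPart hf
        have hge₀ : IsEven σ g₀ := isEven_of_oddPart fun x => by rw [hgo, hf, mul_zero]
        have hhe' : IsEven σ h := hh_eq ▸ isEven_add_smul hfe hhe (-δ)
        refine even_case hfe ?_ hhe'
        rw [hg_eq, ← add_assoc]
        exact isEven_add_smul hfe (isEven_add_smul hhe hge₀ _) _
    · push Not at hho
      obtain ⟨w, hw⟩ := hho
      obtain ⟨ha, hgo, hhe, hho⟩ := P.of_ho_ne_zero hI' hw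
      have hg0 := g₀_eq_zero ha hgo
      have hh0 : IsAdditiveFor 0 h₀ := fun x y => by
        rw [evenPart_add_oddPart σ h₀ (x * y), hhe, hho]
        simp
      have hnodd : ¬ IsOdd σ h₀ := fun hodd => by
        refine one_ne_zero (hI' 0 1 fun x => ?_).2
        simp only [evenPart, isOdd_iff.1 hodd]
        ring
      refine Or.inr (Or.inl ⟨h₀, f, 0, δ, hh0, ?_, ⟨hh0, fun x y => ?_⟩, ?_,
        isAdditiveFor_zero _, isOdd_zero _, Or.inr ⟨rfl, hnodd⟩, ?_, ?_, ?_⟩)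
      · rintro rfl
        exact hnodd (isOdd_zero _)
      · rw [hs', hg0]
      · rintro rfl
        exact one_ne_zero (hI 1 0 fun x => by simp [evenPart]).1
      · rw [add_zero]
      · rw [hg_eq, hg0]; module
      · rw [hh_eq]; module
  · have hodd := (hs.parityData hσ).odd_eq_zero fun a b c habc => by
      have hb : b = 0 := by
        by_contra hb
        refine hdep ⟨-a / b, -c / b, fun x => ?_⟩
        have := habc x
        field_simp
        linear_combination this
      subst hb
      obtain ⟨h1, h2⟩ := hI a c fun x => by linear_combination habc x
      exact ⟨h1, rfl, h2⟩
    exact even_case (isEven_of_oddPart fun x => (hodd x).1)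
      (isEven_of_oddPart fun x => (hodd x).2.1) (isEven_of_oddPart fun x => (hodd x).2.2)

/-! ### The converse: each family solves the equation -/

/-- Pairwise different multiplicative functions, one of which may be zero, are affinely
independent. -/
theorem indep_sub_of_isMultiplicative {χ₁ χ₂ χ₃ : S → ℂ} (h₁ : IsMultiplicative χ₁)
    (h₂ : IsMultiplicative χ₂) (h₃ : IsMultiplicative χ₃) (h12 : χ₁ ≠ χ₂) (h13 : χ₁ ≠ χ₃)
    (h23 : χ₂ ≠ χ₃) : Indep (χ₁ - χ₃) (χ₂ - χ₃) := by
  intro a b hab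
  simp only [Pi.sub_apply] at hab
  -- Dedekind's argument: the relation at `x * y` minus multiples of those at `x` and `y` eliminates
  -- `a`.
  have key : ∀ x y, b * (χ₂ x - χ₁ x) * (χ₂ y - χ₃ y) = 0 := fun x y => by
    have h := hab (x * y)
    rw [h₁, h₂, h₃] at h
    linear_combination h - χ₃ y * hab x - χ₁ x * hab y
  obtain ⟨x, hx⟩ := Function.ne_iff.1 h12.symm
  obtain ⟨y, hy⟩ := Function.ne_iff.1 h23
  obtain ⟨z, hz⟩ := Function.ne_iff.1 h13
  have hb : b = 0 := by simpa [sub_eq_zero, hx, hy] using key x y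
  subst hb
  exact ⟨by simpa [sub_eq_zero, hz] using hab z, rfl⟩

theorem indep_sub_of_isAdditiveFor {μ χ φ : S → ℂ} (hμ : IsMultiplicative μ)
    (hχ : IsMultiplicative χ) (hφ : IsAdditiveFor χ φ) (hne : χ ≠ μ) (hφ0 : φ ≠ 0) :
    Indep (μ - χ) φ := by
  intro a b hab
  simp only [Pi.sub_apply] at hab
  have key : ∀ x y, a * (μ x - χ x) * (μ y - χ y) = 0 := fun x y => by
    have h := hab (x * y)
    rw [hμ, hχ, hφ] at h
    linear_combination h - χ y * hab x - χ x * hab y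
  obtain ⟨x, hx⟩ := Function.ne_iff.1 hne.symm
  obtain ⟨z, hz⟩ := Function.ne_iff.1 hφ0
  have ha : a = 0 := by simpa [sub_eq_zero, hx] using key x x
  subst ha
  exact ⟨rfl, by simpa [show φ z ≠ 0 from hz] using hab z⟩

/-- A solution with even components `f` and `h` that are linearly independent. -/
structure IsEvenSolution (σ : S → S) (f g h : S → ℂ) : Prop where
  isSolution : IsSolution σ f g h
  indep : Indep f h
  even_f : IsEven σ f
  even_h : IsEven σ h

theorem FamilyA.isEvenSolution {σ : S → S} {f g h : S → ℂ} (H : FamilyA σ f g h) :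
    IsEvenSolution σ f g h := by
  obtain ⟨χ, φ, ψ, hχ, hχe, -, hφ, hφe, hφ0, ⟨-, hψ⟩, hψe, -, rfl, rfl, rfl⟩ := H
  rw [isEven_iff] at *
  refine ⟨fun x y => ?_, fun a b hab => ?_, isEven_iff.2 hψe, isEven_iff.2 hφe⟩
  · have := hψ x (σ y)
    rwa [id, hψe, hχe, hφe] at this
  · have key : ∀ x y, a * h x * h y = 0 := fun x y => by
      have h1 := hab (x * y)
      have h2 := hψ x y
      rw [id] at h2
      rw [h2, hφ] at h1
      linear_combination h1 - g y * hab x - g x * hab y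
    obtain ⟨z, hz⟩ := Function.ne_iff.1 hφ0
    have hz' : h z ≠ 0 := hz
    have ha : a = 0 := by simpa [hz'] using key z z
    subst ha
    exact ⟨rfl, by simpa [hz'] using hab z⟩

theorem FamilyB.isEvenSolution {σ : S → S} {f g h : S → ℂ}
    (H : FamilyB σ f g h) : IsEvenSolution σ f g h := by
  obtain ⟨μ, χ, φ, c, hμ, hμe, hχ, hχe, -, hne, hφ, hφe, hφ0, hc, rfl, rfl, rfl⟩ := H
  have hI := indep_sub_of_isAdditiveFor hμ hχ hφ hne hφ0
  rw [isEven_iff] at hμe hχe hφe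
  refine ⟨fun x y => ?_, fun a b hab => ?_, isEven_iff.2 fun x => ?_, isEven_iff.2 fun x => ?_⟩
  · simp only [Pi.sub_apply, Pi.smul_apply, smul_eq_mul, hμ x, hχ x, hφ x, hμe, hχe,
      hφe]
    ring
  · simp only [Pi.sub_apply, Pi.smul_apply, smul_eq_mul] at hab
    obtain ⟨h1, h2⟩ := hI (a * c ^ 2 + b * c) (-a * c) fun x => by
      simp only [Pi.sub_apply]
      linear_combination hab x
    have ha : a = 0 := by simpa [hc] using h2
    subst ha
    exact ⟨rfl, by simpa [hc] using h1⟩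
  · simp only [Pi.sub_apply, Pi.smul_apply, hμe, hχe, hφe]
  · simp only [Pi.sub_apply, Pi.smul_apply, hμe, hχe]

theorem FamilyC.isEvenSolution {σ : S → S} {f g h : S → ℂ}
    (H : FamilyC σ f g h) : IsEvenSolution σ f g h := by
  obtain ⟨μ, χ, φ, c, d, hμ, hμe, hχ, hχe, -, hne, hφ, hφe, hφ0, hc, -, hcd, rfl, rfl, rfl⟩ := H
  have hI := indep_sub_of_isAdditiveFor hμ hχ hφ hne hφ0
  rw [isEven_iff] at hμe hχe hφe
  refine ⟨fun x y => ?_, fun a b hab => ?_, isEven_iff.2 fun x => ?_, isEven_iff.2 hφe⟩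
  · simp only [Pi.add_apply, Pi.sub_apply, Pi.smul_apply, smul_eq_mul, hμ x, hχ x, hφ x, hμe, hχe,
      hφe]
    linear_combination -(h x * h y) * hcd
  · simp only [Pi.add_apply, Pi.sub_apply, Pi.smul_apply, smul_eq_mul] at hab
    obtain ⟨h1, h2⟩ := hI (-a * c) (b - a * c * d) fun x => by
      simp only [Pi.sub_apply]
      linear_combination hab x
    have ha : a = 0 := by simpa [hc] using h1
    subst ha
    exact ⟨rfl, by simpa using h2⟩
  · simp only [Pi.add_apply, Pi.sub_apply, Pi.smul_apply, hμe, hχe, hφe]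

theorem FamilyD.isEvenSolution {σ : S → S} {f g h : S → ℂ}
    (H : FamilyD σ f g h) : IsEvenSolution σ f g h := by
  obtain ⟨χ₁, χ₂, χ₃, α, l, ρ, h₁, e₁, h₂, e₂, h₃, e₃, h12, h13, h23, hα, hl, hρ, hrel,
    rfl, rfl, rfl⟩ := H
  have hI := indep_sub_of_isMultiplicative h₁ h₂ h₃ h12 h13 h23
  rw [isEven_iff] at e₁ e₂ e₃
  refine ⟨fun x y => ?_, fun a b hab => ?_, isEven_iff.2 fun x => ?_, isEven_iff.2 fun x => ?_⟩
  · simp only [Pi.add_apply, Pi.sub_apply, Pi.smul_apply, smul_eq_mul, h₁ x, h₂ x, h₃ x, e₁, e₂, e₃]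
    field_simp
    linear_combination (4 * (χ₁ x - χ₂ x) * (χ₁ y - χ₂ y)) * hrel
  · simp only [Pi.add_apply, Pi.sub_apply, Pi.smul_apply, smul_eq_mul] at hab
    obtain ⟨h1, h2⟩ := hI (a * α * ρ + b * (1 / (2 * l))) (a * α * (2 - ρ) - b * (1 / (2 * l)))
      fun x => by
        simp only [Pi.sub_apply]
        linear_combination hab x
    have h3 : 2 * a * α = 0 := by linear_combination h1 + h2
    have ha : a = 0 := by simpa [hα] using h3
    subst ha
    exact ⟨rfl, by simpa [hl] using h1⟩
  · simp only [Pi.add_apply, Pi.sub_apply, Pi.smul_apply, e₁, e₂, e₃]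
  · simp only [Pi.sub_apply, Pi.smul_apply, e₁, e₂]

/-- The property characterized by the classification is invariant under the change of `g` and `h`
by a parameter. -/
theorem isSolution_and_indep_of_shift {σ : S → S} {f g₀ h₀ g h : S → ℂ} (δ : ℂ)
    (hs : IsSolution σ f g₀ h₀) (hI : Indep (evenPart σ f) (evenPart σ h₀))
    (hg : ∀ x, g x = -(δ ^ 2 / 2) * f x + g₀ x + δ * h₀ x) (hh : ∀ x, h x = -δ * f x + h₀ x) :
    IsSolution σ f g h ∧ Indep (evenPart σ f) (evenPart σ h) := by
  refine ⟨fun x y => ?_, ?_⟩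
  · rw [hs x y, hg, hg, hh, hh]
    ring
  · convert hI.add_smul_left (-δ) using 2 with x
    simp only [evenPart, hh]
    ring

theorem IsEvenSolution.indep_evenPart {σ : S → S} {f g h : S → ℂ} (H : IsEvenSolution σ f g h) :
    Indep (evenPart σ f) (evenPart σ h) := by
  rw [evenPart_of_isEven H.even_f, evenPart_of_isEven H.even_h]
  exact H.indep

theorem FamilyF.isSolution_and_indep {σ : S ≃* S} (hσ : ∀ x, σ (σ x) = x) {f g h : S → ℂ}
    (H : FamilyF σ f g h) : IsSolution σ f g h ∧ Indep (evenPart σ f) (evenPart σ h) := by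
  obtain ⟨Φ, Ψ, k, β, hΦ, hΦ0, ⟨-, hΨ⟩, -, hk, hko, hcases, rfl, rfl, rfl⟩ := H
  have hΦmul : ∀ x y, Φ (x * y) = 0 := fun x y => by simpa using hΦ x y
  have hkmul : ∀ x y, k (x * y) = 0 := fun x y => by simpa using hk x y
  have hΨmul : ∀ x y, Ψ (x * σ y) = Φ x * Φ y := fun x y => by simpa using hΨ x y
  rw [isOdd_iff] at hko
  have hnodd : ∃ w, Φ w + Φ (σ w) ≠ 0 := by
    by_contra! h0
    rcases hcases with ⟨he, -⟩ | ⟨-, hn⟩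
    · refine hΦ0 (funext fun x => ?_)
      have := h0 x
      rw [isEven_iff.1 he] at this
      simpa using this
    · exact hn (isOdd_iff.2 fun x => by linear_combination h0 x)
  refine isSolution_and_indep_of_shift (g₀ := 0) (h₀ := Φ) β (fun x y => ?_) (fun a b hab => ?_)
    (fun x => ?_) (fun x => ?_)
  · simp only [Pi.add_apply, Pi.zero_apply, hkmul, hΨmul]
    ring
  · obtain ⟨w, hw⟩ := hnodd
    simp only [evenPart, Pi.add_apply, hko] at hab
    -- On products `Φ` vanishes, so only the even part of `Ψ` survives. The pairs `(w, w)` and `(w,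
    -- σ w)` then sum to a square.
    have key : ∀ x y, a * (Φ x * Φ y + Φ (σ x) * Φ (σ y)) = 0 := fun x y => by
      have h1 := hab (x * σ y)
      have h2 := hΨmul (σ x) (σ y)
      rw [map_mul, hΨmul, h2, ← map_mul, hΦmul, map_mul, hΦmul] at h1
      linear_combination 2 * h1
    have ha : a = 0 := by
      by_contra ha
      have key' : ∀ x y, Φ x * Φ y + Φ (σ x) * Φ (σ y) = 0 := fun x y => by
        simpa [ha] using key x y
      have h1 := key' w w
      have h2 := key' w (σ w)
      rw [hσ] at h2
      exact hw (by
        have : (Φ w + Φ (σ w)) ^ 2 = 0 := by linear_combination h1 + h2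
        simpa using this)
    subst ha
    refine ⟨rfl, ?_⟩
    have h1 := hab w
    have : b * (Φ w + Φ (σ w)) = 0 := by linear_combination 2 * h1
    exact (mul_eq_zero.1 this).resolve_right hw
  all_goals
    simp only [Pi.add_apply, Pi.smul_apply, smul_eq_mul, Pi.zero_apply]
    ring

theorem FamilyG.isSolution_and_indep {σ : S → S} {f g h : S → ℂ}
    (H : FamilyG σ f g h) : IsSolution σ f g h ∧ Indep (evenPart σ f) (evenPart σ h) := by
  obtain ⟨μ, Φ, k, c, β, hμ, hμe, hμ0, hΦ, hΦe, hΦ0, hk, hko, hc, rfl, rfl, rfl⟩ := H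
  -- The zero function plays the role of `χ`, so `μ` and `Φ` are independent.
  have hI := indep_sub_of_isAdditiveFor hμ (χ := 0) (fun x y => by simp) hΦ hμ0.symm hΦ0
  have hΦmul : ∀ x y, Φ (x * y) = 0 := fun x y => by simpa using hΦ x y
  have hkmul : ∀ x y, k (x * y) = 0 := fun x y => by simpa using hk x y
  rw [isOdd_iff] at hko
  rw [isEven_iff] at hμe hΦe
  refine isSolution_and_indep_of_shift (g₀ := 0) (h₀ := c • μ) β (fun x y => ?_)
    (fun a b hab => ?_) (fun x => ?_) (fun x => ?_)
  · simp only [Pi.add_apply, Pi.sub_apply, Pi.smul_apply, smul_eq_mul, Pi.zero_apply, hkmul,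
      hΦmul, hμ x, hμe]
    ring
  · simp only [evenPart, Pi.add_apply, Pi.sub_apply, Pi.smul_apply, smul_eq_mul, hko, hμe,
      hΦe] at hab
    obtain ⟨h1, h2⟩ := hI (a * c ^ 2 + b * c) (-a * c) fun x => by
      simp only [Pi.sub_apply, Pi.zero_apply]
      linear_combination hab x
    have ha : a = 0 := by simpa [hc] using h2
    subst ha
    exact ⟨rfl, by simpa [hc] using h1⟩
  all_goals
    simp only [Pi.add_apply, Pi.sub_apply, Pi.smul_apply, smul_eq_mul, Pi.zero_apply]
    ring

theorem FamilyE.isSolution_and_indep {σ : S → S} {f g h : S → ℂ}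
    (H : FamilyE σ f g h) : IsSolution σ f g h ∧ Indep (evenPart σ f) (evenPart σ h) := by
  obtain ⟨f₀, g₀, h₀, δ, H, rfl, rfl, rfl⟩ := H
  have H' : IsEvenSolution σ f g₀ h₀ := by
    rcases H with H | H | H | H
    exacts [H.isEvenSolution, H.isEvenSolution, H.isEvenSolution, H.isEvenSolution]
  exact isSolution_and_indep_of_shift δ H'.isSolution H'.indep_evenPart (fun x => rfl)
    (fun x => rfl)

theorem FamilyE.of_familyABCD {σ : S → S} {f g h : S → ℂ}
    (H : FamilyA σ f g h ∨ FamilyB σ f g h ∨ FamilyC σ f g h ∨ FamilyD σ f g h) :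
    FamilyE σ f g h :=
  ⟨f, g, h, 0, H, rfl, by simp, by simp⟩

end CosSine

theorem theorem4p3 {S : Type*} [Semigroup S] (σ : S ≃* S) (hσ : ∀ x, σ (σ x) = x)
    (f g h : S → ℂ) :
    (CosSine.IsSolution σ f g h ∧
      LinearIndependent ℂ ![CosSine.evenPart σ f, CosSine.evenPart σ h]) ↔
    (CosSine.FamilyA σ f g h ∨ CosSine.FamilyB σ f g h ∨ CosSine.FamilyC σ f g h ∨
      CosSine.FamilyD σ f g h ∨ CosSine.FamilyE σ f g h ∨ CosSine.FamilyF σ f g h ∨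
      CosSine.FamilyG σ f g h) := by
  rw [CosSine.linearIndependent_pair_iff_indep]
  constructor
  · rintro ⟨hs, hI⟩
    have := CosSine.classification hσ hs hI
    tauto
  · intro H
    have H' : CosSine.FamilyE σ f g h ∨ CosSine.FamilyF σ f g h ∨ CosSine.FamilyG σ f g h := by
      have := CosSine.FamilyE.of_familyABCD (σ := σ) (f := f) (g := g) (h := h)
      tauto
    rcases H' with H | H | H
    exacts [H.isSolution_and_indep, H.isSolution_and_indep hσ, H.isSolution_and_indep]
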